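/- **Setting.** A refining sequence of partitions of $[0,\infty)$ is a sequence of sets $\mathbb T_n=\{0=t^n_0<t^n_1<\cdots\}$ with $t^n_k\to\infty$ as $k\to\infty$, $\mathbb T_n\subset\mathbb T_{n+1}$, and mesh $\sup_k(t^n_{k+1}-t^n_k)\to0$ as $n\to\infty$. Fix such a sequence, and let $s'$ denote the successor of $s$ in $\mathbb T_n$. A continuous $X:[0,\infty)\to\mathbb R$ belongs to $QV$ if $\langle X\rangle_t=\lim_n\sum_{s\in\mathbb T_n,\,s'\le t}(X_{s'}-X_s)^2$ exists for every $t\ge0$ and is continuous in $t$. A continuous $X=(X^1,\dots,X^d):[0,\infty)\to\mathbb R^d$ belongs to $QV^d$ if $X^i+X^j\in QV$ for all $i,j$. A function $\xi:[0,\infty)\to\mathbb R^d$ is an admissible integrand for $X\in QV^d$ if for each $T>0$ there are $m\in\mathbb N$, open sets $U\subset\mathbb R^d$ and $W\subset\mathbb R^m$, a function $f:U\times W\to\mathbb R$, $(x,a)\mapsto f(x,a)$, that is continuously differentiable in $(x,a)$ and twice continuously differentiable in $x$ (with second $x$-derivatives continuous in $(x,a)$), and a continuous $A:[0,T]\to W$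 of bounded variation, such that $X_t\in U$ and $\xi_t=\nabla_xf(X_t,A_t)$ for $0\le t\le T$. The Föllmer integral is $$\int_0^t\xi_s\,dX_s=\lim_n\sum_{s\in\mathbb T_n,\,s'\le t}\xi_s\cdot(X_{s'}-X_s).$$ The Doléans–Dade exponential of $X\in QV$ is $\mathcal E(X)_t=\exp(X_t-\tfrac12\langle X\rangle_t)$. The Itô logarithm of a positive $Y\in QV$ is $\mathscr L(Y)_t=\log Y_t+\tfrac12\langle\log Y\rangle_t$. Let $S=(S^1,\dots,S^d)\in QV^d$ with $S^i_t>0$ for all $i$ and $t$ (the price trajectories), put $\mathscr L(S)=(\mathscr L(S^1),\dots,\mathscr L(S^d))$, and let $\Delta=\{x\in\mathbb R^d: x^i\ge0,\ \sum_ix^i=1\}$. A portfolio strategy is a function $\pi:[0,\infty)\to\Delta$ that is an admissible integrand for $\mathscr L(S)$. Its portfolio value process is $V^\pi_t=\mathcal E\big(\int_0^\cdot\pi_s\,d\mathscr L(S)_s\big)_t$. Each $\pi\in\Delta$ is identified with the strategy that is constantly equal to $\pi$ (a constant rebalanced portfolio strategy). **Theorem 3.1.** Let $\mu$ be a Borel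 probability measure on $\Delta$. Then $\log S^i\in QV$ for every $i$, and every constant $\pi\in\Delta$ is a portfolio strategy with a well-defined value process $V^\pi$. For every $t\ge0$, the functions $\pi\mapsto V^\pi_t$ and $\pi\mapsto\pi V^\pi_t$ are $\mu$-integrable on $\Delta$, and $$\widehat V_t:=\int_\Delta V^\pi_t\,\mu(d\pi)>0 .$$ Moreover, $$\widehat\pi_t:=\frac{\int_\Delta\pi V^\pi_t\,\mu(d\pi)}{\widehat V_t},\qquad t\ge0,$$ is a portfolio strategy. Its portfolio value process is well defined, that is, the Föllmer integrals $\int_0^t\widehat\pi_s\,d\mathscr L(S)_s$ exist for all $t\ge0$ and form a path in $QV$, and it satisfies $$V^{\widehat\pi}_t=\widehat V_t\qquad\text{for all }t\ge0.$$ The strategy $\widehat\pi$ is called the universal portfolio strategy. -/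

import Mathlib

open Filter Topology MeasureTheory
open scoped NNReal

noncomputable section

namespace PathwiseIto

/-- A refining sequence of partitions of `[0,∞)`. The `n`-th partition is the set
`{pt n 0 < pt n 1 < ...}`, with `pt n 0 = 0` and `pt n k → ∞` as `k → ∞`; the partitions are
increasing in `n` (as sets) and the mesh tends to `0`. The mesh is measured in `[0,∞]`, as it may
be infinite for finitely many `n`. -/
structure RefiningPartitions where
  pt : ℕ → ℕ → ℝ≥0
  pt_zero : ∀ n, pt n 0 = 0
  strictMono : ∀ n, StrictMono (pt n)
  tendsto_atTop : ∀ n, Tendsto (pt n) atTop atTop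
  refining : ∀ n, Set.range (pt n) ⊆ Set.range (pt (n + 1))
  mesh_tendsto : Tendsto (fun n => ⨆ k, edist (pt n k) (pt n (k + 1))) atTop (𝓝 0)

theorem RefiningPartitions.finite_steps (P : RefiningPartitions) (n : ℕ) (t : ℝ≥0) :
    {k : ℕ | P.pt n (k + 1) ≤ t}.Finite := by
  obtain ⟨N, hN⟩ := eventually_atTop.1 ((P.tendsto_atTop n).eventually_gt_atTop t)
  refine (Set.finite_lt_nat N).subset fun k hk => ?_
  by_contra h
  exact absurd (show P.pt n (k + 1) ≤ t from hk)
    (not_le.2 (hN (k + 1) ((not_lt.1 h).trans (Nat.le_succ k))))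

/-- Indices `k` of the points `s = pt n k` of the `n`-th partition whose successor
`s' = pt n (k + 1)` satisfies `s' ≤ t`. -/
def RefiningPartitions.steps (P : RefiningPartitions) (n : ℕ) (t : ℝ≥0) : Finset ℕ :=
  (P.finite_steps n t).toFinset

/-- `∑ (X_{s'} - X_s)²` over the points `s` of the `n`-th partition with `s' ≤ t`. -/
def qvSum (P : RefiningPartitions) (X : ℝ≥0 → ℝ) (n : ℕ) (t : ℝ≥0) : ℝ :=
  ∑ k ∈ P.steps n t, (X (P.pt n (k + 1)) - X (P.pt n k)) ^ 2

/-- The quadratic variation `⟨X⟩_t` (meaningful where the limit exists, see `InQV`). -/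
def quadVar (P : RefiningPartitions) (X : ℝ≥0 → ℝ) (t : ℝ≥0) : ℝ :=
  limUnder atTop fun n => qvSum P X n t

/-- `X ∈ QV`: `X` is continuous and admits a continuous quadratic variation along `P`. -/
structure InQV (P : RefiningPartitions) (X : ℝ≥0 → ℝ) : Prop where
  continuous : Continuous X
  exists_limit : ∀ t, ∃ q : ℝ, Tendsto (fun n => qvSum P X n t) atTop (𝓝 q)
  continuous_quadVar : Continuous (quadVar P X)

/-- `X ∈ QV^d`: `X` is continuous and `X^i + X^j ∈ QV` for all `i, j`. -/
structure InQVd (P : RefiningPartitions) {d : ℕ} (X : ℝ≥0 → Fin d → ℝ) : Prop where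
  continuous : Continuous X
  add_mem : ∀ i j, InQV P fun t => X t i + X t j

/-- `f ∈ C^{2,1}(U, W)`, for open `U`, `W`: the function `f x a` is continuously differentiable in
`(x, a) ∈ U × W` and twice continuously differentiable in `x`, with second derivatives in `x` that
are continuous in `(x, a)`. -/
structure IsC21On {d m : ℕ} (f : (Fin d → ℝ) → (Fin m → ℝ) → ℝ)
    (U : Set (Fin d → ℝ)) (W : Set (Fin m → ℝ)) : Prop where
  contDiffOn_one : ContDiffOn ℝ 1 (fun p : (Fin d → ℝ) × (Fin m → ℝ) => f p.1 p.2) (U ×ˢ W)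
  contDiffOn_two : ∀ a ∈ W, ContDiffOn ℝ 2 (fun x => f x a) U
  continuousOn_second : ContinuousOn
    (fun p : (Fin d → ℝ) × (Fin m → ℝ) => iteratedFDeriv ℝ 2 (fun x => f x p.2) p.1) (U ×ˢ W)

/-- The gradient `∇_x f(x, a) = (f_{x^1}, ..., f_{x^d})`. -/
def gradX {d m : ℕ} (f : (Fin d → ℝ) → (Fin m → ℝ) → ℝ) (x : Fin d → ℝ) (a : Fin m → ℝ) :
    Fin d → ℝ :=
  fun i => fderiv ℝ (fun y => f y a) x (Pi.single i 1)

/-- `A ∈ CBV([0,T], W)`: on `[0,T]`, `A` is continuous, of bounded variation and `W`-valued. -/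
structure IsCBVOn {m : ℕ} (A : ℝ≥0 → Fin m → ℝ) (T : ℝ≥0) (W : Set (Fin m → ℝ)) : Prop where
  continuousOn : ContinuousOn A (Set.Icc 0 T)
  boundedVariationOn : BoundedVariationOn A (Set.Icc 0 T)
  mem : ∀ t ∈ Set.Icc 0 T, A t ∈ W

/-- `ξ` is an admissible integrand for `X ∈ QV^d`. -/
structure IsAdmissibleIntegrand (P : RefiningPartitions) {d : ℕ} (X ξ : ℝ≥0 → Fin d → ℝ) :
    Prop where
  inQVd : InQVd P X
  exists_gradient : ∀ T : ℝ≥0, 0 < T →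
    ∃ (m : ℕ) (U : Set (Fin d → ℝ)) (W : Set (Fin m → ℝ))
      (f : (Fin d → ℝ) → (Fin m → ℝ) → ℝ) (A : ℝ≥0 → Fin m → ℝ),
      IsOpen U ∧ IsOpen W ∧ IsC21On f U W ∧ IsCBVOn A T W ∧
        ∀ t ∈ Set.Icc 0 T, X t ∈ U ∧ ξ t = gradX f (X t) (A t)

/-- The nonanticipative Riemann sum `∑ ξ_s · (X_{s'} - X_s)` over the points `s` of the `n`-th
partition with `s' ≤ t`. -/
def follmerSum (P : RefiningPartitions) {d : ℕ} (ξ X : ℝ≥0 → Fin d → ℝ) (n : ℕ) (t : ℝ≥0) : ℝ :=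
  ∑ k ∈ P.steps n t, ∑ i, ξ (P.pt n k) i * (X (P.pt n (k + 1)) i - X (P.pt n k) i)

/-- The Föllmer integral `∫_0^t ξ_s dX_s` (meaningful where the limit exists). -/
def follmerIntegral (P : RefiningPartitions) {d : ℕ} (ξ X : ℝ≥0 → Fin d → ℝ) (t : ℝ≥0) : ℝ :=
  limUnder atTop fun n => follmerSum P ξ X n t

/-- The Doléans–Dade exponential `ℰ(X)_t = exp(X_t - ⟨X⟩_t / 2)`, for `X ∈ QV`. -/
def ddExp (P : RefiningPartitions) (X : ℝ≥0 → ℝ) (t : ℝ≥0) : ℝ :=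
  Real.exp (X t - 1 / 2 * quadVar P X t)

/-- The Itô logarithm `ℒ(Y)_t = log Y_t + ⟨log Y⟩_t / 2`, for positive `Y ∈ QV`. -/
def itoLog (P : RefiningPartitions) (Y : ℝ≥0 → ℝ) (t : ℝ≥0) : ℝ :=
  Real.log (Y t) + 1 / 2 * quadVar P (fun s => Real.log (Y s)) t

/-- The componentwise Itô logarithm `ℒ(S) = (ℒ(S^1), ..., ℒ(S^d))`. -/
def itoLogVec (P : RefiningPartitions) {d : ℕ} (S : ℝ≥0 → Fin d → ℝ) : ℝ≥0 → Fin d → ℝ :=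
  fun t i => itoLog P (fun s => S s i) t

/-- A portfolio strategy: a `Δ`-valued admissible integrand for `ℒ(S)`. -/
structure IsPortfolioStrategy (P : RefiningPartitions) {d : ℕ} (S π : ℝ≥0 → Fin d → ℝ) :
    Prop where
  mem_simplex : ∀ t, π t ∈ stdSimplex ℝ (Fin d)
  admissible : IsAdmissibleIntegrand P (itoLogVec P S) π

/-- The portfolio value process of `π` is well defined: the Riemann sums for `∫_0^t π_s dℒ(S)_s`
converge for every `t`, and the resulting integral process belongs to `QV`. -/
structure ValueProcessExists (P : RefiningPartitions) {d : ℕ} (S π : ℝ≥0 → Fin d → ℝ) :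
    Prop where
  exists_integral : ∀ t, ∃ I : ℝ,
    Tendsto (fun n => follmerSum P π (itoLogVec P S) n t) atTop (𝓝 I)
  integral_inQV : InQV P (follmerIntegral P π (itoLogVec P S))

/-- The portfolio value process `V^π_t = ℰ(∫_0^· π_s dℒ(S)_s)_t`. -/
def portfolioValue (P : RefiningPartitions) {d : ℕ} (S π : ℝ≥0 → Fin d → ℝ) (t : ℝ≥0) : ℝ :=
  ddExp P (follmerIntegral P π (itoLogVec P S)) t

/-- The constant rebalanced portfolio strategy with weights `π ∈ Δ`. -/
def constRebalanced {d : ℕ} (π : stdSimplex ℝ (Fin d)) : ℝ≥0 → Fin d → ℝ :=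
  fun _ => (π : Fin d → ℝ)

/-- The average `V̂_t = ∫_Δ V^π_t μ(dπ)` of the values of the constant rebalanced strategies. -/
def averageValue (P : RefiningPartitions) {d : ℕ} (S : ℝ≥0 → Fin d → ℝ)
    (μ : Measure (stdSimplex ℝ (Fin d))) (t : ℝ≥0) : ℝ :=
  ∫ π, portfolioValue P S (constRebalanced π) t ∂μ

/-- The universal portfolio `π̂_t = (∫_Δ π V^π_t μ(dπ)) / V̂_t`. -/
def universalPortfolio (P : RefiningPartitions) {d : ℕ} (S : ℝ≥0 → Fin d → ℝ)
    (μ : Measure (stdSimplex ℝ (Fin d))) : ℝ≥0 → Fin d → ℝ :=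
  fun t i =>
    (∫ π, (π : Fin d → ℝ) i * portfolioValue P S (constRebalanced π) t ∂μ) / averageValue P S μ t

end PathwiseIto

end

open PathwiseIto

/-!
Mix the constant rebalanced portfolios `π` with weights proportional to their current values `V^π`:
the universal portfolio is the resulting average `π̂` of `π`. Expanding the exponentials `V^π` along
a step of the partition and averaging, the increment of `V̂ = ∫ V^π dμ` relative to `V̂` is
`π̂ · dX + ∑ i j, E[π^i π^j] (dX^i dX^j - d⟨X^i, X^j⟩) / 2` for `X = ℒ(S)`, up to terms of smaller
order than `|dX|² + d⟨X⟩`. The compensated products in the second sum are negligible: multiplied by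
continuous paths, their sums tend to zero. Taking logarithms, `d log V̂ = π̂ · dX - (π̂ · dX)² / 2`
up to negligible terms, so the Riemann sums of `∫ π̂ dX` converge to `log V̂ + ⟨∫ π̂ dX⟩ / 2`, that
is, `V̂ = ℰ(∫ π̂ dX)`. A constant strategy is the case of a Dirac measure. Since `V^π` depends on
time only through `X` and its covariations, `π̂` is the gradient in `X` of `log V̂`, written as a
function of `X` and of the covariations.
-/

noncomputable section

open Asymptotics

namespace PathwiseIto

section Steps

/-- The left end point of the step `(pt n k, pt n (k + 1)]`, indexed by the pair `(n, k)`. -/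
def RefiningPartitions.left (P : RefiningPartitions) (p : ℕ × ℕ) : ℝ≥0 := P.pt p.1 p.2

/-- The right end point of the step `(pt n k, pt n (k + 1)]`, indexed by the pair `(n, k)`. -/
def RefiningPartitions.right (P : RefiningPartitions) (p : ℕ × ℕ) : ℝ≥0 := P.pt p.1 (p.2 + 1)

variable (P : RefiningPartitions)

/-- The increments of a path, as an array indexed by the steps of all the partitions. -/
def inc {E : Type*} [Sub E] (X : ℝ≥0 → E) (p : ℕ × ℕ) : E := X (P.right p) - X (P.left p)

/-- The sum of an array over the steps of the `n`-th partition that are completed by time `t`. -/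
def stepSum (g : ℕ × ℕ → ℝ) (n : ℕ) (t : ℝ≥0) : ℝ := ∑ k ∈ P.steps n t, g (n, k)

/-- The filter of steps completed by time `t`, as the index of the partition tends to infinity.
Asymptotics along it are uniform over these steps. -/
def stepFilter (t : ℝ≥0) : Filter (ℕ × ℕ) :=
  comap Prod.fst atTop ⊓ 𝓟 {p | P.right p ≤ t}

variable {P} {E : Type*} {s t : ℝ≥0} {n : ℕ} {f g : ℕ × ℕ → ℝ}

theorem left_le_right (p : ℕ × ℕ) : P.left p ≤ P.right p :=
  (P.strictMono p.1).monotone p.2.le_succ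

theorem mem_steps {k : ℕ} : k ∈ P.steps n t ↔ P.right (n, k) ≤ t := by
  simp [RefiningPartitions.steps, RefiningPartitions.right]

theorem steps_zero (n : ℕ) : P.steps n 0 = ∅ := by
  refine Finset.eq_empty_of_forall_notMem fun k hk => (mem_steps.1 hk).not_gt ?_
  rw [← P.pt_zero n]
  exact P.strictMono n k.succ_pos

theorem steps_mono (n : ℕ) : Monotone (P.steps n) := fun _ _ hst _ hk =>
  mem_steps.2 ((mem_steps.1 hk).trans hst)

theorem exists_steps_eq_range (n : ℕ) (t : ℝ≥0) :
    ∃ N, P.steps n t = Finset.range N ∧ P.pt n N ≤ t ∧ t < P.pt n (N + 1) := by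
  classical
  have hex : ∃ k, t < P.pt n k := ((P.tendsto_atTop n).eventually_gt_atTop t).exists
  have hpos : Nat.find hex ≠ 0 := fun h => by simpa [h, P.pt_zero] using Nat.find_spec hex
  obtain ⟨N, hN⟩ := Nat.exists_eq_succ_of_ne_zero hpos
  have hlt : t < P.pt n (N + 1) := by simpa only [hN] using Nat.find_spec hex
  have hle : P.pt n N ≤ t := not_lt.1 (Nat.find_min hex (by omega))
  refine ⟨N, Finset.ext fun k => ?_, hle, hlt⟩
  rw [mem_steps, Finset.mem_range]
  constructor
  · exact fun hk => Nat.succ_lt_succ_iff.1 ((P.strictMono n).lt_iff_lt.1 (hk.trans_lt hlt))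
  · exact fun hk => ((P.strictMono n).monotone hk).trans hle

theorem eventually_stepFilter {q : ℕ × ℕ → Prop} :
    (∀ᶠ p in stepFilter P t, q p) ↔ ∀ᶠ n in atTop, ∀ k, P.right (n, k) ≤ t → q (n, k) := by
  rw [stepFilter, eventually_inf_principal, eventually_comap]
  refine eventually_congr (Eventually.of_forall fun n => ⟨fun h k hk => h (n, k) rfl hk, ?_⟩)
  rintro h ⟨_, k⟩ rfl hk
  exact h k hk

theorem eventually_right_le : ∀ᶠ p in stepFilter P t, P.right p ≤ t :=
  mem_inf_of_right (mem_principal_self _)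

theorem eventually_dist_left_right_lt {δ : ℝ} (hδ : 0 < δ) :
    ∀ᶠ n in atTop, ∀ k, dist (P.left (n, k)) (P.right (n, k)) < δ := by
  filter_upwards [P.mesh_tendsto.eventually_lt_const (ENNReal.ofReal_pos.2 hδ)] with n hn k
  rw [← ENNReal.ofReal_lt_ofReal_iff hδ, ← edist_dist]
  exact (le_iSup (fun k => edist (P.pt n k) (P.pt n (k + 1))) k).trans_lt hn

theorem tendsto_inc [SeminormedAddCommGroup E] {X : ℝ≥0 → E} (hX : Continuous X) (t : ℝ≥0) :
    Tendsto (inc P X) (stepFilter P t) (𝓝 0) := by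
  have hu := isCompact_Icc.uniformContinuousOn_of_continuous (hX.continuousOn (s := Set.Icc 0 t))
  refine Metric.tendsto_nhds.2 fun ε hε => ?_
  obtain ⟨δ, hδ, h⟩ := Metric.uniformContinuousOn_iff.1 hu ε hε
  rw [eventually_stepFilter]
  filter_upwards [eventually_dist_left_right_lt (P := P) hδ] with n hn k hk
  rw [inc, dist_zero_right, ← dist_eq_norm, dist_comm]
  exact h _ ⟨zero_le, (left_le_right _).trans hk⟩ _ ⟨zero_le, hk⟩ (hn k)

theorem isBigO_left_one [SeminormedAddCommGroup E] {h : ℝ≥0 → E} (hh : Continuous h) (t : ℝ≥0) :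
    (fun p => h (P.left p)) =O[stepFilter P t] fun _ => (1 : ℝ) := by
  obtain ⟨B, hB⟩ := isCompact_Icc.exists_bound_of_continuousOn (hh.continuousOn (s := Set.Icc 0 t))
  refine IsBigO.of_bound B ?_
  filter_upwards [eventually_right_le] with p hp
  simpa using hB _ ⟨zero_le, (left_le_right p).trans hp⟩

theorem stepSum_zero (g : ℕ × ℕ → ℝ) (n : ℕ) : stepSum P g n 0 = 0 := by
  simp [stepSum, steps_zero]

theorem stepSum_add (f g : ℕ × ℕ → ℝ) (n : ℕ) (t : ℝ≥0) :
    stepSum P (fun p => f p + g p) n t = stepSum P f n t + stepSum P g n t :=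
  Finset.sum_add_distrib

theorem stepSum_sub (f g : ℕ × ℕ → ℝ) (n : ℕ) (t : ℝ≥0) :
    stepSum P (fun p => f p - g p) n t = stepSum P f n t - stepSum P g n t :=
  Finset.sum_sub_distrib _ _

theorem stepSum_const_mul (c : ℝ) (g : ℕ × ℕ → ℝ) (n : ℕ) (t : ℝ≥0) :
    stepSum P (fun p => c * g p) n t = c * stepSum P g n t :=
  (Finset.mul_sum _ _ _).symm

theorem stepSum_sum {ι : Type*} (s : Finset ι) (g : ι → ℕ × ℕ → ℝ) (n : ℕ) (t : ℝ≥0) :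
    stepSum P (fun p => ∑ i ∈ s, g i p) n t = ∑ i ∈ s, stepSum P (g i) n t :=
  Finset.sum_comm

theorem abs_stepSum_sub_le (hst : s ≤ t)
    (h : ∀ k, s < P.right (n, k) → P.right (n, k) ≤ t → |f (n, k)| ≤ g (n, k)) :
    |stepSum P f n t - stepSum P f n s| ≤ stepSum P g n t - stepSum P g n s := by
  have sub_eq (f : ℕ × ℕ → ℝ) : stepSum P f n t - stepSum P f n s =
      ∑ k ∈ P.steps n t \ P.steps n s, f (n, k) := by
    rw [stepSum, stepSum, ← Finset.sum_sdiff (steps_mono n hst), add_sub_cancel_right]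
  rw [sub_eq, sub_eq]
  refine (Finset.abs_sum_le_sum_abs _ _).trans (Finset.sum_le_sum fun k hk => ?_)
  rw [Finset.mem_sdiff, mem_steps, mem_steps, not_le] at hk
  exact h k hk.2 hk.1

theorem abs_stepSum_le (h : ∀ k, P.right (n, k) ≤ t → |f (n, k)| ≤ g (n, k)) :
    |stepSum P f n t| ≤ stepSum P g n t := by
  simpa [stepSum_zero] using abs_stepSum_sub_le (zero_le : (0 : ℝ≥0) ≤ t) fun k _ => h k

theorem tendsto_stepSum_inc {X : ℝ≥0 → ℝ} (hX : Continuous X) (t : ℝ≥0) :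
    Tendsto (stepSum P (inc P X) · t) atTop (𝓝 (X t - X 0)) := by
  choose N hN hle hlt using fun n => exists_steps_eq_range (P := P) n t
  have hlim : Tendsto (fun n => P.pt n (N n)) atTop (𝓝 t) := by
    refine Metric.tendsto_nhds.2 fun ε hε => ?_
    filter_upwards [eventually_dist_left_right_lt (P := P) hε] with n hn
    have hstep := hn (N n)
    simp only [RefiningPartitions.left, RefiningPartitions.right] at hstep
    have hle' := NNReal.coe_le_coe.2 (hle n)
    have hlt' := NNReal.coe_lt_coe.2 (hlt n)
    rw [NNReal.dist_eq, abs_of_nonpos (by linarith)] at hstep ⊢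
    linarith
  have htelescope (n : ℕ) : stepSum P (inc P X) n t = X (P.pt n (N n)) - X 0 := by
    rw [stepSum, hN]
    exact (Finset.sum_range_sub (fun k => X (P.pt n k)) _).trans (by rw [P.pt_zero])
  simp only [htelescope]
  exact ((hX.tendsto t).comp hlim).sub_const _

theorem tendsto_stepSum_of_isLittleO {κ : ℕ × ℕ → ℝ} {B : ℝ}
    (hg : g =o[stepFilter P t] κ) (hB : ∀ᶠ n in atTop, stepSum P (fun p => |κ p|) n t ≤ B) :
    Tendsto (stepSum P g · t) atTop (𝓝 0) := by
  refine Metric.tendsto_nhds.2 fun ε hε => ?_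
  have hc : 0 < ε / (|B| + 1) := by positivity
  filter_upwards [eventually_stepFilter.1 (hg.def hc), hB] with n hgn hBn
  rw [Real.dist_eq, sub_zero]
  calc |stepSum P g n t| ≤ stepSum P (fun p => ε / (|B| + 1) * |κ p|) n t := abs_stepSum_le hgn
    _ = ε / (|B| + 1) * stepSum P (fun p => |κ p|) n t := stepSum_const_mul ..
    _ ≤ ε / (|B| + 1) * |B| := by gcongr; exact hBn.trans (le_abs_self B)
    _ < ε := by rw [div_mul_eq_mul_div, div_lt_iff₀ (by positivity)]; nlinarith

end Steps

section WeightedSums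

variable {P : RefiningPartitions} {h : ℝ≥0 → ℝ} {g : ℕ × ℕ → ℝ} {t : ℝ≥0} {ε B : ℝ}

variable (P) in
/-- The Riemann–Stieltjes sum of `h` against the path `t ↦ stepSum P g n t`, over the grid
`τ 0, …, τ N`. -/
def gridSum (h : ℝ≥0 → ℝ) (g : ℕ × ℕ → ℝ) (τ : ℕ → ℝ≥0) (N n : ℕ) : ℝ :=
  ∑ j ∈ Finset.range N, h (τ j) * (stepSum P g n (τ (j + 1)) - stepSum P g n (τ j))

theorem abs_stepSum_sub_gridSum_le {n : ℕ} {τ : ℕ → ℝ≥0} (hτ0 : τ 0 = 0) (hτ : Monotone τ) (N : ℕ)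
    (hh : ∀ j < N, ∀ k, τ j < P.right (n, k) → P.right (n, k) ≤ τ (j + 1) →
      |h (P.left (n, k)) - h (τ j)| ≤ ε) :
    |stepSum P (fun p => h (P.left p) * g p) n (τ N) - gridSum P h g τ N n| ≤
      ε * stepSum P (fun p => |g p|) n (τ N) := by
  induction N with
  | zero => simp [hτ0, stepSum_zero, gridSum]
  | succ N ih =>
    have hinit := ih fun j hj => hh j (hj.trans N.lt_succ_self)
    have hlast := abs_stepSum_sub_le (f := fun p => h (P.left p) * g p - h (τ N) * g p)
      (g := fun p => ε * |g p|) (hτ N.le_succ) fun k hlt hle => by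
        rw [← sub_mul, abs_mul]
        gcongr
        exact hh N N.lt_succ_self k hlt hle
    simp only [stepSum_sub, stepSum_const_mul] at hlast
    rw [gridSum, Finset.sum_range_succ, ← gridSum]
    rw [abs_le] at hinit hlast ⊢
    constructor <;> linarith [hlast.1, hlast.2, hinit.1, hinit.2]

theorem exists_grid_abs_sub_le (hh : Continuous h) (t : ℝ≥0) (hε : 0 < ε) :
    ∃ (N : ℕ) (τ : ℕ → ℝ≥0), τ 0 = 0 ∧ Monotone τ ∧ τ N = t ∧
      ∀ᶠ n in atTop, ∀ j < N, ∀ k, τ j < P.right (n, k) → P.right (n, k) ≤ τ (j + 1) →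
        |h (P.left (n, k)) - h (τ j)| ≤ ε := by
  have hu := isCompact_Icc.uniformContinuousOn_of_continuous (hh.continuousOn (s := Set.Icc 0 t))
  obtain ⟨δ, hδ, hu⟩ := Metric.uniformContinuousOn_iff.1 hu ε hε
  obtain ⟨N, hN⟩ := exists_nat_gt ((t : ℝ) / (δ / 2))
  have hN0 : (0 : ℝ) < N := lt_of_le_of_lt (by positivity) hN
  let τ : ℕ → ℝ≥0 := fun j => t * (j / N)
  have hτN : τ N = t := by
    simp only [τ]
    rw [div_self (by exact_mod_cast hN0.ne'), mul_one]
  have hτmono : Monotone τ := fun i j hij => by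
    simp only [τ]
    gcongr
  have hτstep (j : ℕ) : (τ (j + 1) : ℝ) < τ j + δ / 2 := by
    have hmesh : (t : ℝ) / N < δ / 2 := by
      rw [div_lt_iff₀ (half_pos hδ)] at hN
      rw [div_lt_iff₀ hN0]
      linarith
    have : (τ (j + 1) : ℝ) = τ j + t / N := by simp only [τ]; push_cast; ring
    linarith
  refine ⟨N, τ, by simp [τ], hτmono, hτN, ?_⟩
  filter_upwards [eventually_dist_left_right_lt (P := P) (half_pos hδ)] with n hn j hj k hlt hle
  have hright : P.right (n, k) ≤ t := hle.trans (hτN ▸ hτmono (Nat.succ_le_of_lt hj))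
  refine (hu _ ⟨zero_le, (left_le_right _).trans hright⟩ _ ⟨zero_le, hlt.le.trans hright⟩ ?_).le
  have hdist : dist (P.right (n, k)) (τ j) < δ / 2 := by
    rw [NNReal.dist_eq, abs_of_nonneg (sub_nonneg.2 (NNReal.coe_le_coe.2 hlt.le))]
    linarith [hτstep j, NNReal.coe_le_coe.2 hle]
  linarith [dist_triangle (P.left (n, k)) (P.right (n, k)) (τ j), hn k]

theorem exists_eventually_abs_stepSum_sub_lt (hh : Continuous h) {G : ℝ≥0 → ℝ}
    (hG : ∀ s, Tendsto (stepSum P g · s) atTop (𝓝 (G s)))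
    (hB : ∀ᶠ n in atTop, stepSum P (fun p => |g p|) n t ≤ B) (hε : 0 < ε) :
    ∃ (N : ℕ) (τ : ℕ → ℝ≥0), ∀ᶠ n in atTop, |stepSum P (fun p => h (P.left p) * g p) n t -
      ∑ j ∈ Finset.range N, h (τ j) * (G (τ (j + 1)) - G (τ j))| < ε := by
  obtain ⟨N, τ, hτ0, hτ, hτN, hosc⟩ := exists_grid_abs_sub_le (P := P) hh t
    (show 0 < ε / 2 / (|B| + 1) by positivity)
  have hlim : Tendsto (gridSum P h g τ N) atTop
      (𝓝 (∑ j ∈ Finset.range N, h (τ j) * (G (τ (j + 1)) - G (τ j)))) :=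
    tendsto_finsetSum _ fun j _ => ((hG _).sub (hG _)).const_mul _
  refine ⟨N, τ, ?_⟩
  filter_upwards [hosc, hB, Metric.tendsto_nhds.1 hlim (ε / 2) (half_pos hε)] with n hosc hB hgrid
  have hle := abs_stepSum_sub_gridSum_le (g := g) hτ0 hτ N hosc
  rw [hτN] at hle
  have hsmall : ε / 2 / (|B| + 1) * stepSum P (fun p => |g p|) n t ≤ ε / 2 := by
    rw [div_mul_eq_mul_div, div_le_iff₀ (by positivity)]
    nlinarith [hB.trans (le_abs_self B)]
  rw [Real.dist_eq] at hgrid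
  exact (abs_sub_le _ _ _).trans_lt (by linarith)

theorem exists_tendsto_stepSum_mul (hh : Continuous h)
    (hg : ∀ s, ∃ l, Tendsto (stepSum P g · s) atTop (𝓝 l))
    (hB : ∀ᶠ n in atTop, stepSum P (fun p => |g p|) n t ≤ B) :
    ∃ l, Tendsto (stepSum P (fun p => h (P.left p) * g p) · t) atTop (𝓝 l) := by
  choose G hG using hg
  refine cauchySeq_tendsto_of_complete (Metric.cauchySeq_iff'.2 fun ε hε => ?_)
  obtain ⟨N, τ, hn⟩ := exists_eventually_abs_stepSum_sub_lt hh hG hB (half_pos hε)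
  obtain ⟨n₀, hn₀⟩ := eventually_atTop.1 hn
  exact ⟨n₀, fun n hn => (dist_triangle_right _ _ _).trans_lt
    (add_lt_add (hn₀ n hn) (hn₀ n₀ le_rfl) |>.trans_eq (add_halves ε))⟩

theorem tendsto_stepSum_mul_zero (hh : Continuous h)
    (hg : ∀ s, Tendsto (stepSum P g · s) atTop (𝓝 0))
    (hB : ∀ᶠ n in atTop, stepSum P (fun p => |g p|) n t ≤ B) :
    Tendsto (stepSum P (fun p => h (P.left p) * g p) · t) atTop (𝓝 0) := by
  refine Metric.tendsto_nhds.2 fun ε hε => ?_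
  obtain ⟨N, τ, hn⟩ := exists_eventually_abs_stepSum_sub_lt hh hg hB hε
  simpa [Real.dist_eq] using hn

end WeightedSums

section Control

theorem tendsto_quadVar {P : RefiningPartitions} {X : ℝ≥0 → ℝ} (hX : InQV P X) (t : ℝ≥0) :
    Tendsto (stepSum P (fun p => inc P X p ^ 2) · t) atTop (𝓝 (quadVar P X t)) :=
  tendsto_nhds_limUnder (hX.exists_limit t)

theorem quadVar_eq_of_tendsto {P : RefiningPartitions} {X : ℝ≥0 → ℝ} {t : ℝ≥0} {q : ℝ}
    (h : Tendsto (stepSum P (fun p => inc P X p ^ 2) · t) atTop (𝓝 q)) : quadVar P X t = q :=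
  h.limUnder_eq

theorem inQV_of_tendsto {P : RefiningPartitions} {X q : ℝ≥0 → ℝ} (hX : Continuous X)
    (hq : Continuous q)
    (h : ∀ t, Tendsto (stepSum P (fun p => inc P X p ^ 2) · t) atTop (𝓝 (q t))) : InQV P X :=
  ⟨hX, fun t => ⟨q t, h t⟩, (funext fun t => quadVar_eq_of_tendsto (h t) : quadVar P X = q) ▸ hq⟩

variable (P : RefiningPartitions) {d : ℕ} (X : ℝ≥0 → Fin d → ℝ)

/-- The array of the squared Euclidean norms of the increments of `X`. -/
def energy (p : ℕ × ℕ) : ℝ := ∑ i, inc P X p i ^ 2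

/-- The total quadratic variation `∑ i, ⟨X^i⟩` of a path in `QV^d`. -/
def totalVar (t : ℝ≥0) : ℝ := ∑ i, quadVar P (X · i) t

/-- The array against which remainders are measured: the squared increments of `X` together with
the increments of its total quadratic variation. Its sums are bounded, so arrays of smaller order
have vanishing sums. -/
def control (p : ℕ × ℕ) : ℝ := energy P X p + inc P (totalVar P X) p

/-- The square root of the control, the order of magnitude of the increments of `X`. -/
def rootControl (p : ℕ × ℕ) : ℝ := √(control P X p)

variable {P X}

theorem energy_nonneg (p : ℕ × ℕ) : 0 ≤ energy P X p :=
  Finset.sum_nonneg fun _ _ => sq_nonneg _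

namespace InQVd

variable (hX : InQVd P X) {g : ℕ × ℕ → ℝ} {t : ℝ≥0}

include hX

theorem inQV (i : Fin d) : InQV P (X · i) := by
  have h := hX.add_mem i i
  refine inQV_of_tendsto ((continuous_apply i).comp hX.continuous)
    (h.continuous_quadVar.const_mul (1 / 4)) fun t => ?_
  refine ((tendsto_quadVar h t).const_mul (1 / 4)).congr fun n => ?_
  rw [← stepSum_const_mul]
  congr! 2 with p
  simp only [inc]
  ring

theorem continuous_totalVar : Continuous (totalVar P X) :=
  continuous_finsetSum _ fun i _ => (hX.inQV i).continuous_quadVar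

theorem tendsto_stepSum_energy (t : ℝ≥0) :
    Tendsto (stepSum P (energy P X) · t) atTop (𝓝 (totalVar P X t)) :=
  (tendsto_finsetSum Finset.univ fun i _ => tendsto_quadVar (hX.inQV i) t).congr fun n =>
    (stepSum_sum _ _ n t).symm

theorem totalVar_mono : Monotone (totalVar P X) := fun s t hst =>
  le_of_tendsto_of_tendsto' (hX.tendsto_stepSum_energy s) (hX.tendsto_stepSum_energy t) fun n =>
    Finset.sum_le_sum_of_subset_of_nonneg (steps_mono n hst) fun _ _ _ => energy_nonneg _

theorem inc_totalVar_nonneg (p : ℕ × ℕ) : 0 ≤ inc P (totalVar P X) p :=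
  sub_nonneg.2 (hX.totalVar_mono (left_le_right p))

theorem control_nonneg (p : ℕ × ℕ) : 0 ≤ control P X p :=
  add_nonneg (energy_nonneg p) (hX.inc_totalVar_nonneg p)

theorem tendsto_stepSum_control (t : ℝ≥0) :
    Tendsto (stepSum P (control P X) · t) atTop
      (𝓝 (totalVar P X t + (totalVar P X t - totalVar P X 0))) :=
  ((hX.tendsto_stepSum_energy t).add (tendsto_stepSum_inc hX.continuous_totalVar t)).congr
    fun n => (stepSum_add _ _ n t).symm

theorem tendsto_control (t : ℝ≥0) : Tendsto (control P X) (stepFilter P t) (𝓝 0) := by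
  have henergy : Tendsto (energy P X) (stepFilter P t) (𝓝 (∑ _i : Fin d, (0 : ℝ) ^ 2)) :=
    tendsto_finsetSum _ fun i _ => (tendsto_inc (hX.inQV i).continuous t).pow 2
  simp only [ne_eq, OfNat.ofNat_ne_zero, not_false_eq_true, zero_pow, Finset.sum_const_zero]
    at henergy
  rw [← add_zero (0 : ℝ)]
  exact henergy.add (tendsto_inc hX.continuous_totalVar t)

theorem exists_stepSum_abs_le_of_isBigO (hg : g =O[stepFilter P t] control P X) :
    ∃ B, ∀ᶠ n in atTop, stepSum P (fun p => |g p|) n t ≤ B := by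
  obtain ⟨c, hc⟩ := hg.bound
  obtain ⟨B, hB⟩ := ((hX.tendsto_stepSum_control t).const_mul c).isBoundedUnder_le
  refine ⟨B, ?_⟩
  filter_upwards [eventually_stepFilter.1 hc, hB] with n hn hle
  refine le_trans ?_ ((stepSum_const_mul c _ n t).trans_le hle)
  refine Finset.sum_le_sum fun k hk => (hn k (mem_steps.1 hk)).trans_eq ?_
  rw [Real.norm_of_nonneg (hX.control_nonneg _)]

theorem rootControl_mul_self (p : ℕ × ℕ) :
    rootControl P X p * rootControl P X p = control P X p :=
  Real.mul_self_sqrt (hX.control_nonneg p)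

theorem isBigO_mul {f : ℕ × ℕ → ℝ} (hf : f =O[stepFilter P t] rootControl P X)
    (hg : g =O[stepFilter P t] rootControl P X) :
    (fun p => f p * g p) =O[stepFilter P t] control P X :=
  (hf.mul hg).congr_right hX.rootControl_mul_self

theorem tendsto_rootControl (t : ℝ≥0) : Tendsto (rootControl P X) (stepFilter P t) (𝓝 0) := by
  rw [← Real.sqrt_zero]
  exact (hX.tendsto_control t).sqrt

theorem control_isLittleO_rootControl (t : ℝ≥0) :
    control P X =o[stepFilter P t] rootControl P X := by
  simpa only [hX.rootControl_mul_self, one_mul] using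
    ((isLittleO_one_iff ℝ).2 (hX.tendsto_rootControl t)).mul_isBigO
      (isBigO_refl (rootControl P X) _)

theorem mul_isLittleO_control {A : Type*} [NormedRing A] {f g : ℕ × ℕ → A}
    (hf : f =O[stepFilter P t] rootControl P X) (hg : g =O[stepFilter P t] control P X) :
    (fun p => f p * g p) =o[stepFilter P t] control P X := by
  simpa only [one_mul] using
    ((isLittleO_one_iff ℝ).2 (hf.trans_tendsto (hX.tendsto_rootControl t))).mul_isBigO hg

theorem norm_pow_three_isLittleO_control {E : Type*} [SeminormedAddCommGroup E] {f : ℕ × ℕ → E}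
    (hf : f =O[stepFilter P t] rootControl P X) :
    (fun p => ‖f p‖ ^ 3) =o[stepFilter P t] control P X :=
  (hX.mul_isLittleO_control hf.norm_left (hX.isBigO_mul hf.norm_left hf.norm_left)).congr_left
    fun p => by ring

theorem inc_isBigO_rootControl (t : ℝ≥0) : inc P X =O[stepFilter P t] rootControl P X := by
  refine isBigO_pi.2 fun i => IsBigO.of_bound 1 (Eventually.of_forall fun p => ?_)
  rw [one_mul, Real.norm_eq_abs, rootControl, Real.norm_of_nonneg (Real.sqrt_nonneg _)]
  refine Real.abs_le_sqrt (le_add_of_le_of_nonneg ?_ (hX.inc_totalVar_nonneg p))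
  exact Finset.single_le_sum (f := fun i => inc P X p i ^ 2) (fun _ _ => sq_nonneg _)
    (Finset.mem_univ i)

theorem inc_totalVar_isBigO (t : ℝ≥0) :
    inc P (totalVar P X) =O[stepFilter P t] control P X := by
  refine IsBigO.of_bound 1 (Eventually.of_forall fun p => ?_)
  rw [one_mul, Real.norm_of_nonneg (hX.inc_totalVar_nonneg p),
    Real.norm_of_nonneg (hX.control_nonneg p)]
  exact le_add_of_nonneg_left (energy_nonneg p)

end InQVd

end Control

section HasLimSum

/-- The sums of the array `g` up to time `t` converge to `G t`, and `g` is of at most the order of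
the control of `X`. The case `G = 0` describes the arrays that are negligible in second order
expansions. -/
structure HasLimSum (P : RefiningPartitions) {d : ℕ} (X : ℝ≥0 → Fin d → ℝ) (g : ℕ × ℕ → ℝ)
    (G : ℝ≥0 → ℝ) : Prop where
  isBigO : ∀ t, g =O[stepFilter P t] control P X
  tendsto : ∀ t, Tendsto (stepSum P g · t) atTop (𝓝 (G t))

variable {P : RefiningPartitions} {d : ℕ} {X : ℝ≥0 → Fin d → ℝ} {f g : ℕ × ℕ → ℝ}
  {F G h : ℝ≥0 → ℝ}

namespace HasLimSum

theorem add (hf : HasLimSum P X f F) (hg : HasLimSum P X g G) :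
    HasLimSum P X (fun p => f p + g p) (F + G) where
  isBigO t := (hf.isBigO t).add (hg.isBigO t)
  tendsto t := ((hf.tendsto t).add (hg.tendsto t)).congr fun n => (stepSum_add f g n t).symm

theorem congr_left (hf : HasLimSum P X f F) (hfg : ∀ p, f p = g p) : HasLimSum P X g F :=
  funext hfg ▸ hf

theorem const_mul (hg : HasLimSum P X g G) (c : ℝ) :
    HasLimSum P X (fun p => c * g p) (c • G) where
  isBigO t := (hg.isBigO t).const_mul_left c
  tendsto t := ((hg.tendsto t).const_mul c).congr fun n => (stepSum_const_mul c g n t).symm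

theorem sum {ι : Type*} {s : Finset ι} {g : ι → ℕ × ℕ → ℝ} {G : ι → ℝ≥0 → ℝ}
    (hg : ∀ i ∈ s, HasLimSum P X (g i) (G i)) :
    HasLimSum P X (fun p => ∑ i ∈ s, g i p) (fun t => ∑ i ∈ s, G i t) where
  isBigO t := IsBigO.fun_sum fun i hi => (hg i hi).isBigO t
  tendsto t := (tendsto_finsetSum s fun i hi => (hg i hi).tendsto t).congr fun n =>
    (stepSum_sum s g n t).symm

theorem isBigO_left_mul (hg : HasLimSum P X g G) (hh : Continuous h) (t : ℝ≥0) :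
    (fun p => h (P.left p) * g p) =O[stepFilter P t] control P X := by
  simpa using (isBigO_left_one hh t).mul (hg.isBigO t)

theorem exists_left_mul (hX : InQVd P X) (hg : HasLimSum P X g G) (hh : Continuous h) :
    ∃ G', HasLimSum P X (fun p => h (P.left p) * g p) G' := by
  have hlim (t : ℝ≥0) : ∃ l, Tendsto (stepSum P (fun p => h (P.left p) * g p) · t) atTop (𝓝 l) :=
    have ⟨_, hB⟩ := hX.exists_stepSum_abs_le_of_isBigO (hg.isBigO t)
    exists_tendsto_stepSum_mul hh (fun s => ⟨G s, hg.tendsto s⟩) hB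
  choose G' hG' using hlim
  exact ⟨G', hg.isBigO_left_mul hh, hG'⟩

theorem left_mul_zero (hX : InQVd P X) (hg : HasLimSum P X g 0) (hh : Continuous h) :
    HasLimSum P X (fun p => h (P.left p) * g p) 0 where
  isBigO := hg.isBigO_left_mul hh
  tendsto t :=
    have ⟨_, hB⟩ := hX.exists_stepSum_abs_le_of_isBigO (hg.isBigO t)
    tendsto_stepSum_mul_zero hh hg.tendsto hB

theorem of_isLittleO (hX : InQVd P X) (hg : ∀ t, g =o[stepFilter P t] control P X) :
    HasLimSum P X g 0 where
  isBigO t := (hg t).isBigO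
  tendsto t :=
    have ⟨_, hB⟩ := hX.exists_stepSum_abs_le_of_isBigO (isBigO_refl (control P X) _)
    tendsto_stepSum_of_isLittleO (hg t) hB

theorem clm_apply_of_isLittleO {E : Type*} [NormedAddCommGroup E] [NormedSpace ℝ E]
    {L : ℝ≥0 → E →L[ℝ] ℝ} {R : ℕ × ℕ → E} (hX : InQVd P X) (hL : Continuous L)
    (hR : ∀ t, R =o[stepFilter P t] control P X) :
    HasLimSum P X (fun p => L (P.left p) (R p)) 0 := by
  refine of_isLittleO hX fun t => isBoundedBilinearMap_apply.isBigO_comp.trans_isLittleO ?_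
  simpa only [one_mul] using (isBigO_left_one hL t).norm_left.mul_isLittleO (hR t).norm_left

theorem apply_zero (hg : HasLimSum P X g G) : G 0 = 0 :=
  tendsto_nhds_unique (hg.tendsto 0) (by simp [stepSum_zero])

theorem exists_dist_le (hX : InQVd P X) (hg : HasLimSum P X g G) (T : ℝ≥0) :
    ∃ c, ∀ s ≤ T, ∀ t ≤ T, dist (G s) (G t) ≤ c * dist (totalVar P X s) (totalVar P X t) := by
  obtain ⟨c, hc⟩ := (hg.isBigO T).bound
  refine ⟨2 * c, fun s hs t ht => ?_⟩
  wlog hst : s ≤ t generalizing s t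
  · rw [dist_comm (G s), dist_comm (totalVar P X s)]
    exact this t ht s hs (le_of_not_ge hst)
  have hlim := ((hX.tendsto_stepSum_control t).sub (hX.tendsto_stepSum_control s)).const_mul c
  rw [dist_comm, dist_comm (totalVar P X s), Real.dist_eq,
    Real.dist_eq, abs_of_nonneg (sub_nonneg.2 (hX.totalVar_mono hst))]
  refine (le_of_tendsto_of_tendsto ((hg.tendsto t).sub (hg.tendsto s)).abs hlim ?_).trans_eq
    (by ring)
  filter_upwards [eventually_stepFilter.1 hc] with n hn
  refine (abs_stepSum_sub_le (g := fun p => c * control P X p) hst fun k _ hk => ?_).trans_eq ?_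
  · simpa [abs_of_nonneg (hX.control_nonneg _)] using hn k (hk.trans ht)
  · rw [stepSum_const_mul, stepSum_const_mul, mul_sub]

theorem continuous (hX : InQVd P X) (hg : HasLimSum P X g G) : Continuous G := by
  refine continuous_iff_continuousAt.2 fun t => tendsto_iff_dist_tendsto_zero.2 ?_
  obtain ⟨c, hc⟩ := hg.exists_dist_le hX (t + 1)
  have hlim := (tendsto_iff_dist_tendsto_zero.1 (hX.continuous_totalVar.tendsto t)).const_mul c
  rw [mul_zero] at hlim
  refine squeeze_zero' (Eventually.of_forall fun _ => dist_nonneg) ?_ hlim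
  filter_upwards [Iic_mem_nhds (lt_add_one t)] with s hs
  exact hc s hs t le_self_add

theorem inc_isBigO (hX : InQVd P X) (hg : HasLimSum P X g G) (t : ℝ≥0) :
    inc P G =O[stepFilter P t] control P X := by
  obtain ⟨c, hc⟩ := hg.exists_dist_le hX t
  refine IsBigO.trans (IsBigO.of_bound c ?_) (hX.inc_totalVar_isBigO t)
  filter_upwards [eventually_right_le] with p hp
  simpa only [inc, dist_eq_norm] using hc _ hp _ ((left_le_right p).trans hp)

theorem sub_inc (hX : InQVd P X) (hg : HasLimSum P X g G) :
    HasLimSum P X (fun p => g p - inc P G p) 0 where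
  isBigO t := (hg.isBigO t).sub (hg.inc_isBigO hX t)
  tendsto t := by
    have hlim := (hg.tendsto t).sub (tendsto_stepSum_inc (P := P) (hg.continuous hX) t)
    simpa [hg.apply_zero, stepSum_sub] using hlim

end HasLimSum

end HasLimSum

section Expansions

theorem exp_sub_isBigO (A : Type*) [NormedRing A] [NormedAlgebra ℝ A] [CompleteSpace A] :
    (fun y : A => NormedSpace.exp y - (1 + y + (1 / 2 : ℝ) • y ^ 2)) =O[𝓝 0] fun y => ‖y‖ ^ 3 := by
  have := (NormedSpace.exp_hasFPowerSeriesAt_zero (𝕂 := ℝ) (𝔸 := A)).isBigO_sub_partialSum_pow 3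
  simpa [FormalMultilinearSeries.partialSum, Finset.sum_range_succ,
    NormedSpace.expSeries_apply_eq] using this

theorem log_one_add_sub_isBigO :
    (fun u : ℝ => Real.log (1 + u) - (u - 1 / 2 * u ^ 2)) =O[𝓝 0] fun u => u ^ 3 := by
  refine IsBigO.of_bound 2 ?_
  filter_upwards [Metric.ball_mem_nhds (0 : ℝ) one_half_pos] with u hu
  rw [mem_ball_zero_iff, Real.norm_eq_abs] at hu
  have hlog := Real.abs_log_sub_add_sum_range_le (x := -u) (by rw [abs_neg]; linarith) 2
  rw [abs_neg] at hlog
  rw [norm_pow, Real.norm_eq_abs, Real.norm_eq_abs, mul_comm]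
  refine le_trans (le_of_eq ?_) (hlog.trans ?_)
  · congr 1
    simp only [Finset.sum_range_succ, Finset.sum_range_zero, sub_neg_eq_add]
    push_cast
    ring
  · rw [div_le_iff₀ (by linarith), mul_right_comm]
    exact le_mul_of_one_le_left (by positivity) (by linarith)

theorem exp_continuousMap_apply {K : Type*} [TopologicalSpace K] [CompactSpace K] (g : C(K, ℝ))
    (x : K) : NormedSpace.exp g x = Real.exp (g x) := by
  rw [NormedSpace.exp_continuousMap_eq, Real.exp_eq_exp_ℝ]
  rfl

end Expansions

section Bracket

variable (P : RefiningPartitions) {d : ℕ} (X : ℝ≥0 → Fin d → ℝ)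

/-- The covariations `⟨X^i, X^j⟩` of a path in `QV^d`, obtained by polarization, as a vector indexed
by the pairs `(i, j)`. -/
def bracket (t : ℝ≥0) (q : Fin d × Fin d) : ℝ :=
  1 / 2 * (quadVar P (fun s => X s q.1 + X s q.2) t - quadVar P (X · q.1) t -
    quadVar P (X · q.2) t)

variable {P X}

theorem InQVd.hasLimSum_bracket (hX : InQVd P X) (q : Fin d × Fin d) :
    HasLimSum P X (fun p => inc P X p q.1 * inc P X p q.2) (bracket P X · q) where
  isBigO t := hX.isBigO_mul (isBigO_pi.1 (hX.inc_isBigO_rootControl t) q.1)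
    (isBigO_pi.1 (hX.inc_isBigO_rootControl t) q.2)
  tendsto t := by
    refine ((((tendsto_quadVar (hX.add_mem q.1 q.2) t).sub (tendsto_quadVar (hX.inQV q.1) t)).sub
      (tendsto_quadVar (hX.inQV q.2) t)).const_mul (1 / 2)).congr fun n => ?_
    rw [← stepSum_sub, ← stepSum_sub, ← stepSum_const_mul]
    congr! 2 with p
    simp only [inc, Pi.sub_apply]
    ring

theorem InQVd.continuous_bracket (hX : InQVd P X) : Continuous (bracket P X) :=
  continuous_pi fun q => (hX.hasLimSum_bracket q).continuous hX

theorem InQVd.bracket_zero (hX : InQVd P X) : bracket P X 0 = 0 :=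
  funext fun q => (hX.hasLimSum_bracket q).apply_zero

theorem boundedVariationOn_of_dist_le {α E F : Type*} [LinearOrder α] [PseudoMetricSpace E]
    [PseudoMetricSpace F] {f : α → E} {v : α → F} {s : Set α} {c : ℝ}
    (hv : BoundedVariationOn v s)
    (hf : ∀ x ∈ s, ∀ y ∈ s, dist (f x) (f y) ≤ c * dist (v x) (v y)) :
    BoundedVariationOn f s := by
  refine ne_top_of_le_ne_top (ENNReal.mul_ne_top (ENNReal.ofReal_ne_top (r := c)) hv)
    (iSup_le fun p => ?_)
  refine le_trans ?_ (mul_le_mul_right (eVariationOn.sum_le (n := p.1) p.2.2.1 p.2.2.2) _)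
  rw [Finset.mul_sum]
  refine Finset.sum_le_sum fun k _ => ?_
  rw [edist_dist, edist_dist, ← ENNReal.ofReal_mul' dist_nonneg]
  exact ENNReal.ofReal_le_ofReal (hf _ (p.2.2.2 _) _ (p.2.2.2 _))

theorem HasLimSum.boundedVariationOn {ι : Type*} [Fintype ι] (hX : InQVd P X)
    {g : ι → ℕ × ℕ → ℝ} {G : ℝ≥0 → ι → ℝ} (hg : ∀ b, HasLimSum P X (g b) (G · b)) (T : ℝ≥0) :
    BoundedVariationOn G (Set.Icc 0 T) := by
  have htotalVar : BoundedVariationOn (totalVar P X) (Set.Icc 0 T) := by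
    simpa using (hX.totalVar_mono.monotoneOn (Set.Icc 0 T)).locallyBoundedVariationOn 0 T
      ⟨le_rfl, zero_le⟩ ⟨zero_le, le_rfl⟩
  choose c hc using fun b => (hg b).exists_dist_le hX T
  obtain ⟨C, hC⟩ := Finite.exists_le c
  refine boundedVariationOn_of_dist_le (c := |C|) htotalVar fun s hs t ht => ?_
  refine (dist_pi_le_iff (by positivity)).2 fun b => (hc b s hs.2 t ht.2).trans ?_
  gcongr
  exact (hC b).trans (le_abs_self C)

end Bracket

section ControlledPaths

variable (P : RefiningPartitions) {d : ℕ} (X : ℝ≥0 → Fin d → ℝ)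

/-- The summands `h_s · (X_{s'} - X_s)` of the nonanticipative Riemann sums, as an array. -/
def gain (h X : ℝ≥0 → Fin d → ℝ) (p : ℕ × ℕ) : ℝ := h (P.left p) ⬝ᵥ inc P X p

/-- `Y` is controlled by `X`, with derivative `h`: the increments of `Y` are `h · dX` up to terms
of smaller order than the increments of `X`. -/
def IsControlledBy (Y : ℝ≥0 → ℝ) (h : ℝ≥0 → Fin d → ℝ) : Prop :=
  ∀ t, (fun p => inc P Y p - gain P h X p) =o[stepFilter P t] rootControl P X

variable {P X} {Y Z : ℝ≥0 → ℝ} {h k : ℝ≥0 → Fin d → ℝ}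

theorem InQVd.gain_isBigO_rootControl (hX : InQVd P X) (hh : Continuous h) (t : ℝ≥0) :
    gain P h X =O[stepFilter P t] rootControl P X := by
  change (fun p => ∑ i, h (P.left p) i * inc P X p i) =O[stepFilter P t] rootControl P X
  refine IsBigO.fun_sum fun i _ => ?_
  have hleft : (fun p => h (P.left p) i) =O[stepFilter P t] fun _ => (1 : ℝ) :=
    isBigO_left_one (by fun_prop : Continuous fun t => h t i) t
  simpa using hleft.mul (isBigO_pi.1 (hX.inc_isBigO_rootControl t) i)

theorem InQVd.exists_hasLimSum_sq_gain (hX : InQVd P X) (hh : Continuous h) :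
    ∃ Q, HasLimSum P X (fun p => gain P h X p ^ 2) Q := by
  choose Q hQ using fun q : Fin d × Fin d =>
    (hX.hasLimSum_bracket q).exists_left_mul hX (h := fun t => h t q.1 * h t q.2) (by fun_prop)
  refine ⟨_, (HasLimSum.sum (s := Finset.univ) fun q _ => hQ q).congr_left fun p => ?_⟩
  rw [sq, gain, dotProduct, Fintype.sum_mul_sum, Fintype.sum_prod_type]
  exact Fintype.sum_congr _ _ fun i => Fintype.sum_congr _ _ fun j => by ring

namespace IsControlledBy

theorem add (hY : IsControlledBy P X Y h) (hZ : IsControlledBy P X Z k) :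
    IsControlledBy P X (fun t => Y t + Z t) (h + k) := fun t =>
  ((hY t).add (hZ t)).congr_left fun p => by
    simp only [inc, gain, Pi.add_apply, add_dotProduct]
    ring

theorem of_isBigO_control (hX : InQVd P X)
    (hY : ∀ t, inc P Y =O[stepFilter P t] control P X) : IsControlledBy P X Y 0 := fun t =>
  ((hY t).trans_isLittleO (hX.control_isLittleO_rootControl t)).congr_left fun p => by
    simp only [gain, Pi.zero_apply, zero_dotProduct, sub_zero]

theorem apply (i : Fin d) : IsControlledBy P X (X · i) fun _ => Pi.single i 1 := fun t =>
  (isLittleO_zero _ _).congr_left fun p => by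
    simp only [gain, single_dotProduct, one_mul]
    exact (sub_self _).symm

theorem hasLimSum_sq (hX : InQVd P X) (hh : Continuous h) (hY : IsControlledBy P X Y h)
    {Q : ℝ≥0 → ℝ} (hQ : HasLimSum P X (fun p => gain P h X p ^ 2) Q) :
    HasLimSum P X (fun p => inc P Y p ^ 2) Q := by
  have hdiff : HasLimSum P X (fun p => inc P Y p ^ 2 - gain P h X p ^ 2) 0 := by
    refine .of_isLittleO hX fun t => ?_
    have hgain := (hX.gain_isBigO_rootControl hh t).const_mul_left 2
    refine ((hY t).mul_isBigO ((hY t).isBigO.add hgain)).congr (fun p => ?_)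
      hX.rootControl_mul_self
    ring
  simpa using hQ.add hdiff

theorem inQV (hX : InQVd P X) (hh : Continuous h) (hYc : Continuous Y)
    (hY : IsControlledBy P X Y h) : InQV P Y :=
  have ⟨_, hQ⟩ := hX.exists_hasLimSum_sq_gain hh
  inQV_of_tendsto hYc (hQ.continuous hX) (hY.hasLimSum_sq hX hh hQ).tendsto

theorem inQVd (hX : InQVd P X) {m : ℕ} {Y : ℝ≥0 → Fin m → ℝ} {h : Fin m → ℝ≥0 → Fin d → ℝ}
    (hh : ∀ i, Continuous (h i)) (hYc : Continuous Y)
    (hY : ∀ i, IsControlledBy P X (Y · i) (h i)) : InQVd P Y where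
  continuous := hYc
  add_mem i j := ((hY i).add (hY j)).inQV hX ((hh i).add (hh j)) (by fun_prop)

theorem log (hX : InQVd P X) (hh : Continuous h) (hYc : Continuous Y) (hpos : ∀ t, 0 < Y t)
    (hY : IsControlledBy P X Y h) :
    IsControlledBy P X (fun t => Real.log (Y t)) fun t => (Y t)⁻¹ • h t := by
  intro t
  have hinv : (fun p => (Y (P.left p))⁻¹) =O[stepFilter P t] fun _ => (1 : ℝ) :=
    isBigO_left_one (hYc.inv₀ fun t => (hpos t).ne') t
  have hratio : (fun p => (Y (P.left p))⁻¹ * inc P Y p) =O[stepFilter P t] rootControl P X := by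
    simpa using hinv.mul ((hY t).isBigO.add (hX.gain_isBigO_rootControl hh t))
  have hlog : (fun p => inc P (fun t => Real.log (Y t)) p - (Y (P.left p))⁻¹ * inc P Y p)
      =o[stepFilter P t] rootControl P X := by
    have hderiv := hasDerivAt_iff_isLittleO_nhds_zero.1 (Real.hasDerivAt_log one_ne_zero)
    refine ((hderiv.comp_tendsto (hratio.trans_tendsto (hX.tendsto_rootControl t))).trans_isBigO
      hratio).congr_left fun p => ?_
    have hleft := (hpos (P.left p)).ne'
    have hone_add : 1 + (Y (P.left p))⁻¹ * inc P Y p = Y (P.right p) / Y (P.left p) := by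
      rw [inc]; field_simp; ring
    simp only [Function.comp_apply, hone_add, Real.log_div (hpos (P.right p)).ne' hleft,
      Real.log_one, inv_one, smul_eq_mul]
    simp only [inc]
    ring
  have hremainder := hinv.mul_isLittleO (hY t)
  simp only [one_mul] at hremainder
  refine (hlog.add hremainder).congr_left fun p => ?_
  simp only [gain, smul_dotProduct, smul_eq_mul]
  ring

theorem inQV_log (hX : InQVd P X) (hh : Continuous h) (hYc : Continuous Y) (hpos : ∀ t, 0 < Y t)
    (hY : IsControlledBy P X Y h) : InQV P fun t => Real.log (Y t) :=
  (hY.log hX hh hYc hpos).inQV hX ((hYc.inv₀ fun t => (hpos t).ne').smul hh)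
    (hYc.log fun t => (hpos t).ne')

theorem itoLog (hX : InQVd P X) (hh : Continuous h) (hYc : Continuous Y) (hpos : ∀ t, 0 < Y t)
    (hY : IsControlledBy P X Y h) :
    IsControlledBy P X (itoLog P Y) fun t => (Y t)⁻¹ • h t := by
  have hinv : Continuous fun t => (Y t)⁻¹ • h t := (hYc.inv₀ fun t => (hpos t).ne').smul hh
  have hlog := hY.log hX hh hYc hpos
  obtain ⟨Q, hQ⟩ := hX.exists_hasLimSum_sq_gain hinv
  have hquadVar_eq : quadVar P (fun s => Real.log (Y s)) = Q :=
    funext fun t => quadVar_eq_of_tendsto ((hlog.hasLimSum_sq hX hinv hQ).tendsto t)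
  have hquadVar : IsControlledBy P X (fun t => 1 / 2 * quadVar P (fun s => Real.log (Y s)) t) 0 :=
    hquadVar_eq ▸ .of_isBigO_control hX ((hQ.const_mul (1 / 2)).inc_isBigO hX)
  rw [← add_zero fun t => (Y t)⁻¹ • h t]
  exact hlog.add hquadVar

end IsControlledBy

namespace InQVd

variable (hX : InQVd P X) (hpos : ∀ t i, 0 < X t i)

include hX hpos

theorem inQV_log (i : Fin d) : InQV P fun t => Real.log (X t i) :=
  (IsControlledBy.apply i).inQV_log hX continuous_const ((continuous_apply i).comp hX.continuous)
    (hpos · i)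

theorem itoLogVec : InQVd P (itoLogVec P X) := by
  have hXc (i : Fin d) : Continuous (X · i) := (continuous_apply i).comp hX.continuous
  refine IsControlledBy.inQVd hX (fun i => ?_) (continuous_pi fun i => ?_) fun i =>
    (IsControlledBy.apply i).itoLog hX continuous_const (hXc i) (hpos · i)
  · exact ((hXc i).inv₀ fun t => (hpos t i).ne').smul continuous_const
  · exact ((hXc i).log fun t => (hpos t i).ne').add
      ((hX.inQV_log hpos i).continuous_quadVar.const_mul _)

end InQVd

end ControlledPaths

section FollmerIntegral

variable (P : RefiningPartitions) {d : ℕ} (X h : ℝ≥0 → Fin d → ℝ) (Z : ℝ≥0 → ℝ)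

/-- `Z` is the logarithm of the Doléans–Dade exponential of `∫ h dX`, up to its initial value:
its increments are `h · dX - (h · dX)² / 2` up to negligible terms. -/
def IsLogExponential : Prop :=
  HasLimSum P X (fun p => inc P Z p - (gain P h X p - 1 / 2 * gain P h X p ^ 2)) 0

variable {P X h Z}

namespace IsLogExponential

theorem of_exp (hX : InQVd P X) (hh : Continuous h)
    (hZ : HasLimSum P X (fun p => Real.exp (inc P Z p) - (1 + gain P h X p)) 0) :
    IsLogExponential P X h Z := by
  have hgain := hX.gain_isBigO_rootControl hh
  let u : ℕ × ℕ → ℝ := fun p => Real.exp (inc P Z p) - 1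
  have hdiff (t : ℝ≥0) : (fun p => u p - gain P h X p) =O[stepFilter P t] control P X :=
    (hZ.isBigO t).congr_left fun p => by simp only [u]; ring
  have hu (t : ℝ≥0) : u =O[stepFilter P t] rootControl P X :=
    (((hdiff t).trans (hX.control_isLittleO_rootControl t).isBigO).add (hgain t)).congr_left
      fun p => by ring
  have hlog : HasLimSum P X (fun p => Real.log (1 + u p) - (u p - 1 / 2 * u p ^ 2)) 0 := by
    refine .of_isLittleO hX fun t => ?_
    refine (log_one_add_sub_isBigO.comp_tendsto
      ((hu t).trans_tendsto (hX.tendsto_rootControl t))).trans_isLittleO ?_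
    simpa only [← norm_pow, isLittleO_norm_left, Function.comp_def] using
      hX.norm_pow_three_isLittleO_control (hu t)
  have hsq : HasLimSum P X (fun p => (u p + gain P h X p) * (u p - gain P h X p)) 0 :=
    .of_isLittleO hX fun t => hX.mul_isLittleO_control ((hu t).add (hgain t)) (hdiff t)
  rw [IsLogExponential, show (0 : ℝ≥0 → ℝ) = 0 + 0 + (-1 / 2 : ℝ) • 0 by simp]
  refine ((hZ.add hlog).add (hsq.const_mul (-1 / 2))).congr_left fun p => ?_
  simp only [u, add_sub_cancel, Real.log_exp]
  ring

theorem tendsto_follmerSum (hZc : Continuous Z) (hZ : IsLogExponential P X h Z) {Q : ℝ≥0 → ℝ}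
    (hQ : HasLimSum P X (fun p => gain P h X p ^ 2) Q) (t : ℝ≥0) :
    Tendsto (follmerSum P h X · t) atTop (𝓝 (Z t - Z 0 + 1 / 2 * Q t)) := by
  have hlim := ((tendsto_stepSum_inc (P := P) hZc t).add ((hQ.tendsto t).const_mul (1 / 2))).sub
    (HasLimSum.tendsto hZ t)
  rw [Pi.zero_apply, sub_zero] at hlim
  refine hlim.congr fun n => ?_
  rw [← stepSum_const_mul, ← stepSum_add, ← stepSum_sub]
  refine Finset.sum_congr rfl fun k _ => (?_ : _ = gain P h X (n, k))
  ring

variable (hX : InQVd P X) (hh : Continuous h) (hZc : Continuous Z) (hZ : IsLogExponential P X h Z)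

include hX hh hZc hZ

theorem exists_tendsto_follmerSum (t : ℝ≥0) :
    ∃ I, Tendsto (follmerSum P h X · t) atTop (𝓝 I) :=
  have ⟨_, hQ⟩ := hX.exists_hasLimSum_sq_gain hh
  ⟨_, hZ.tendsto_follmerSum hZc hQ t⟩

theorem continuous_follmerIntegral : Continuous (follmerIntegral P h X) := by
  obtain ⟨Q, hQ⟩ := hX.exists_hasLimSum_sq_gain hh
  rw [(funext fun t => (hZ.tendsto_follmerSum hZc hQ t).limUnder_eq :
    follmerIntegral P h X = fun t => Z t - Z 0 + 1 / 2 * Q t)]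
  exact (hZc.sub continuous_const).add ((hQ.continuous hX).const_mul _)

theorem isControlledBy_follmerIntegral : IsControlledBy P X (follmerIntegral P h X) h := by
  obtain ⟨Q, hQ⟩ := hX.exists_hasLimSum_sq_gain hh
  have hQ2 := hQ.const_mul (1 / 2)
  intro t
  refine ((((HasLimSum.isBigO hZ t).sub (hQ2.isBigO t)).add
    (hQ2.inc_isBigO hX t)).trans_isLittleO (hX.control_isLittleO_rootControl t)).congr_left
    fun p => ?_
  have hintegral (s : ℝ≥0) : follmerIntegral P h X s = Z s - Z 0 + 1 / 2 * Q s :=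
    (hZ.tendsto_follmerSum hZc hQ s).limUnder_eq
  simp only [inc, hintegral, Pi.smul_apply, smul_eq_mul]
  ring

theorem inQV_follmerIntegral : InQV P (follmerIntegral P h X) :=
  (hZ.isControlledBy_follmerIntegral hX hh hZc).inQV hX hh
    (hZ.continuous_follmerIntegral hX hh hZc)

theorem ddExp_follmerIntegral (t : ℝ≥0) :
    ddExp P (follmerIntegral P h X) t = Real.exp (Z t - Z 0) := by
  obtain ⟨Q, hQ⟩ := hX.exists_hasLimSum_sq_gain hh
  have hsq := (hZ.isControlledBy_follmerIntegral hX hh hZc).hasLimSum_sq hX hh hQ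
  rw [ddExp, quadVar_eq_of_tendsto (hsq.tendsto t), follmerIntegral,
    (hZ.tendsto_follmerSum hZc hQ t).limUnder_eq, add_sub_cancel_right]

end IsLogExponential

end FollmerIntegral

section LogPartition

variable {K : Type*} [TopologicalSpace K] [CompactSpace K] [MeasurableSpace K] [BorelSpace K]
  (μ : Measure K) [IsFiniteMeasure μ]

theorem integrable_continuousMap (g : C(K, ℝ)) : Integrable g μ :=
  g.continuous.integrable_of_hasCompactSupport (HasCompactSupport.of_compactSpace g)

/-- Integration against a finite measure, as a continuous linear functional on `C(K, ℝ)`. -/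
def integralCLM : C(K, ℝ) →L[ℝ] ℝ :=
  LinearMap.mkContinuous
    { toFun := fun g => ∫ x, g x ∂μ
      map_add' := fun f g =>
        integral_add (integrable_continuousMap μ f) (integrable_continuousMap μ g)
      map_smul' := fun c g => integral_const_mul c g }
    (μ.real Set.univ) fun g =>
      (norm_integral_le_of_norm_le_const (Eventually.of_forall g.norm_coe_le_norm)).trans_eq
        (mul_comm _ _)

/-- The logarithm of the partition function of the exponent `g`, `log ∫ exp g dμ`. -/
def logPartition (g : C(K, ℝ)) : ℝ := Real.log (∫ x, Real.exp (g x) ∂μ)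

/-- The mean value functional of the Gibbs measure with density proportional to `exp g`. -/
def tiltedMean (g : C(K, ℝ)) : C(K, ℝ) →L[ℝ] ℝ := integralCLM (μ.tilted g)

theorem integral_exp_eq_integralCLM (g : C(K, ℝ)) :
    ∫ x, Real.exp (g x) ∂μ = integralCLM μ (NormedSpace.exp g) :=
  integral_congr_ae (Eventually.of_forall fun x => (exp_continuousMap_apply g x).symm)

theorem integrable_exp_continuousMap (g : C(K, ℝ)) : Integrable (fun x => Real.exp (g x)) μ :=
  integrable_continuousMap μ ⟨_, Real.continuous_exp.comp g.continuous⟩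

variable [NeZero μ]

theorem integral_exp_continuousMap_pos (g : C(K, ℝ)) : 0 < ∫ x, Real.exp (g x) ∂μ :=
  integral_exp_pos (integrable_exp_continuousMap μ g)

theorem exp_logPartition (g : C(K, ℝ)) :
    Real.exp (logPartition μ g) = ∫ x, Real.exp (g x) ∂μ :=
  Real.exp_log (integral_exp_continuousMap_pos μ g)

theorem contDiff_logPartition {n : WithTop ℕ∞} : ContDiff ℝ n (logPartition μ) := by
  have hexp : ContDiff ℝ n (NormedSpace.exp : C(K, ℝ) → C(K, ℝ)) :=
    AnalyticOnNhd.contDiff fun g _ => NormedSpace.exp_analytic g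
  refine ContDiff.log ?_ fun g => (integral_exp_continuousMap_pos μ g).ne'
  simp only [integral_exp_eq_integralCLM]
  exact (integralCLM μ).contDiff.comp hexp

theorem hasFDerivAt_logPartition (g : C(K, ℝ)) :
    HasFDerivAt (logPartition μ) (tiltedMean μ g) g := by
  have hpartition : HasFDerivAt (fun g : C(K, ℝ) => ∫ x, Real.exp (g x) ∂μ)
      ((integralCLM μ).comp (NormedSpace.exp g • (1 : C(K, ℝ) →L[ℝ] C(K, ℝ)))) g := by
    simp only [integral_exp_eq_integralCLM]
    exact (integralCLM μ).hasFDerivAt.comp g hasFDerivAt_exp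
  refine (hpartition.log (integral_exp_continuousMap_pos μ g).ne').congr_fderiv ?_
  ext v
  change (∫ x, Real.exp (g x) ∂μ)⁻¹ * ∫ x, NormedSpace.exp g x * v x ∂μ = ∫ x, v x ∂μ.tilted g
  simp only [integral_tilted, exp_continuousMap_apply, smul_eq_mul, div_mul_eq_mul_div]
  rw [integral_div, div_eq_inv_mul]

theorem continuous_tiltedMean : Continuous (tiltedMean μ) := by
  have hfderiv : fderiv ℝ (logPartition μ) = tiltedMean μ :=
    funext fun g => (hasFDerivAt_logPartition μ g).fderiv
  exact hfderiv ▸ (contDiff_logPartition μ (n := 1)).continuous_fderiv one_ne_zero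

theorem tiltedMean_one (g : C(K, ℝ)) : tiltedMean μ g 1 = 1 := by
  have := isProbabilityMeasure_tilted (integrable_exp_continuousMap μ g)
  change ∫ _, (1 : ℝ) ∂μ.tilted g = 1
  simp

theorem tiltedMean_exp (g y : C(K, ℝ)) :
    tiltedMean μ g (NormedSpace.exp y) = Real.exp (logPartition μ (g + y) - logPartition μ g) := by
  rw [tiltedMean, ← integral_exp_eq_integralCLM, integral_exp_tilted, Real.exp_sub,
    exp_logPartition, exp_logPartition]
  rfl

end LogPartition

section Mixtures

/-- The linear map `x ↦ ∑ i, x i • φ i`, as a continuous linear map. -/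
def linearCombinationCLM {ι E : Type*} [Fintype ι] [NormedAddCommGroup E] [NormedSpace ℝ E]
    (φ : ι → E) : (ι → ℝ) →L[ℝ] E :=
  (Fintype.linearCombination ℝ φ).toContinuousLinearMap

theorem linearCombinationCLM_apply {ι E : Type*} [Fintype ι] [NormedAddCommGroup E]
    [NormedSpace ℝ E] (φ : ι → E) (x : ι → ℝ) : linearCombinationCLM φ x = ∑ i, x i • φ i :=
  rfl

theorem apply_linearCombinationCLM {ι E : Type*} [Fintype ι] [NormedAddCommGroup E]
    [NormedSpace ℝ E] (L : E →L[ℝ] ℝ) (φ : ι → E) (x : ι → ℝ) :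
    L (linearCombinationCLM φ x) = ∑ i, L (φ i) * x i := by
  simp only [linearCombinationCLM_apply, map_sum, map_smul, smul_eq_mul, mul_comm]

theorem linearCombinationCLM_comp_equiv {ι κ E : Type*} [Fintype ι] [Fintype κ]
    [NormedAddCommGroup E] [NormedSpace ℝ E] (e : κ ≃ ι) (φ : ι → E) (x : ι → ℝ) :
    linearCombinationCLM (φ ∘ e) (x ∘ e) = linearCombinationCLM φ x :=
  Equiv.sum_comp e fun i => x i • φ i

/-- The family of the products of pairs of elements of a family. -/
def pairMul {ι A : Type*} [Mul A] (φ : ι → A) (q : ι × ι) : A := φ q.1 * φ q.2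

theorem linearCombinationCLM_sq {ι A : Type*} [Fintype ι] [NormedCommRing A] [NormedAlgebra ℝ A]
    (φ : ι → A) (x : ι → ℝ) :
    linearCombinationCLM φ x ^ 2 = linearCombinationCLM (pairMul φ) (pairMul x) := by
  simp only [linearCombinationCLM_apply, sq, Fintype.sum_mul_sum, Fintype.sum_prod_type, pairMul,
    smul_mul_smul_comm]

section LogValue

variable (P : RefiningPartitions) {d : ℕ} (X : ℝ≥0 → Fin d → ℝ)

/-- The products of the increments of `X`, compensated by the increments of the covariations. -/
def compensated (p : ℕ × ℕ) : Fin d × Fin d → ℝ := pairMul (inc P X p) - inc P (bracket P X) p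

variable {A : Type*} [NormedCommRing A] [NormedAlgebra ℝ A] (φ : Fin d → A)

/-- The logarithms of the values of a family of constant weights. In the algebra of functions on a
space of parameters, `φ i` assigns to each parameter the weight of `X^i`, and the value at a
parameter with weights `w` is `w · (X_t - X_0) - ∑ i j, w_i w_j ⟨X^i, X^j⟩_t / 2`. -/
def logValue (t : ℝ≥0) : A :=
  linearCombinationCLM φ (X t - X 0) -
    (1 / 2 : ℝ) • linearCombinationCLM (pairMul φ) (bracket P X t)

variable {P X}

namespace InQVd

variable (hX : InQVd P X)

include hX

theorem hasLimSum_compensated (q : Fin d × Fin d) : HasLimSum P X (compensated P X · q) 0 :=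
  (hX.hasLimSum_bracket q).sub_inc hX

theorem inc_bracket_isBigO (t : ℝ≥0) : inc P (bracket P X) =O[stepFilter P t] control P X :=
  isBigO_pi.2 fun q => (hX.hasLimSum_bracket q).inc_isBigO hX t

theorem continuous_logValue : Continuous (logValue P X φ) := by
  have hXc := hX.continuous
  have hbracket := hX.continuous_bracket
  unfold logValue
  fun_prop

theorem logValue_zero : logValue P X φ 0 = 0 := by
  rw [logValue, hX.bracket_zero, sub_self, map_zero, map_zero, smul_zero, sub_zero]

theorem exp_inc_logValue_isLittleO [CompleteSpace A] (t : ℝ≥0) :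
    (fun p => NormedSpace.exp (inc P (logValue P X φ) p) - (1 + linearCombinationCLM φ (inc P X p) +
      (1 / 2 : ℝ) • linearCombinationCLM (pairMul φ) (compensated P X p)))
      =o[stepFilter P t] control P X := by
  let a : ℕ × ℕ → A := fun p => linearCombinationCLM φ (inc P X p)
  let b : ℕ × ℕ → A := fun p => linearCombinationCLM (pairMul φ) (inc P (bracket P X) p)
  have hinc (p : ℕ × ℕ) : inc P (logValue P X φ) p = a p - (1 / 2 : ℝ) • b p := by
    simp only [a, b, inc, logValue, map_sub]
    module
  have ha : a =O[stepFilter P t] rootControl P X :=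
    ((linearCombinationCLM φ).isBigO_comp _ _).trans (hX.inc_isBigO_rootControl t)
  have hb : b =O[stepFilter P t] control P X :=
    ((linearCombinationCLM (pairMul φ)).isBigO_comp _ _).trans (hX.inc_bracket_isBigO t)
  have hbroot := hb.trans (hX.control_isLittleO_rootControl t).isBigO
  have hy : inc P (logValue P X φ) =O[stepFilter P t] rootControl P X :=
    (ha.sub (hbroot.const_smul_left (1 / 2 : ℝ))).congr_left fun p => (hinc p).symm
  have hexp := ((exp_sub_isBigO A).comp_tendsto
    (hy.trans_tendsto (hX.tendsto_rootControl t))).trans_isLittleO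
    (hX.norm_pow_three_isLittleO_control hy)
  have hcross := hX.mul_isLittleO_control
    ((hbroot.const_smul_left (1 / 8 : ℝ)).sub (ha.const_smul_left (1 / 2 : ℝ))) hb
  refine (hexp.add hcross).congr_left fun p => ?_
  have hcompensated : linearCombinationCLM (pairMul φ) (compensated P X p) = a p ^ 2 - b p := by
    rw [linearCombinationCLM_sq, compensated, map_sub]
  simp only [Function.comp_apply, Pi.smul_apply, hinc, hcompensated, sq, sub_mul, mul_sub,
    smul_mul_assoc, mul_smul_comm, mul_comm (b p) (a p)]
  module

end InQVd

end LogValue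

section MixedWeights

variable {P : RefiningPartitions} {d : ℕ} {X : ℝ≥0 → Fin d → ℝ}
variable {K : Type*} [TopologicalSpace K] [CompactSpace K] [MeasurableSpace K] [BorelSpace K]
  (φ : Fin d → C(K, ℝ)) (μ : Measure K) [IsFiniteMeasure μ]

variable (P X) in
/-- The average of the weights `φ` with respect to the measure with density proportional to the
values of these weights. -/
def mixedWeights (t : ℝ≥0) (i : Fin d) : ℝ := tiltedMean μ (logValue P X φ t) (φ i)

variable [NeZero μ] (hX : InQVd P X)

include hX

theorem InQVd.continuous_tiltedMean_logValue :
    Continuous fun t => tiltedMean μ (logValue P X φ t) :=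
  (continuous_tiltedMean μ).comp (hX.continuous_logValue φ)

theorem InQVd.continuous_mixedWeights : Continuous (mixedWeights P X φ μ) :=
  continuous_pi fun _ => (hX.continuous_tiltedMean_logValue φ μ).clm_apply continuous_const

theorem InQVd.continuous_logPartition_logValue :
    Continuous fun t => logPartition μ (logValue P X φ t) :=
  (contDiff_logPartition μ (n := 0)).continuous.comp (hX.continuous_logValue φ)

theorem InQVd.isLogExponential_logPartition :
    IsLogExponential P X (mixedWeights P X φ μ) fun t => logPartition μ (logValue P X φ t) := by
  let L (t : ℝ≥0) : C(K, ℝ) →L[ℝ] ℝ := tiltedMean μ (logValue P X φ t)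
  have hL : Continuous L := hX.continuous_tiltedMean_logValue φ μ
  let R (p : ℕ × ℕ) : C(K, ℝ) := NormedSpace.exp (inc P (logValue P X φ) p) -
    (1 + linearCombinationCLM φ (inc P X p) +
      (1 / 2 : ℝ) • linearCombinationCLM (pairMul φ) (compensated P X p))
  have hR : HasLimSum P X (fun p => L (P.left p) (R p)) 0 :=
    .clm_apply_of_isLittleO hX hL (hX.exp_inc_logValue_isLittleO φ)
  have hcompensated : HasLimSum P X
      (fun p => ∑ q, L (P.left p) (pairMul φ q) * compensated P X p q) fun _ => ∑ _q, 0 :=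
    .sum fun q _ => (hX.hasLimSum_compensated q).left_mul_zero hX (hL.clm_apply continuous_const)
  refine .of_exp hX (hX.continuous_mixedWeights φ μ) ?_
  rw [show (0 : ℝ≥0 → ℝ) = 0 + (1 / 2 : ℝ) • fun _ => ∑ _q : Fin d × Fin d, 0 by ext; simp]
  refine (hR.add (hcompensated.const_mul (1 / 2))).congr_left fun p => ?_
  have hexp : L (P.left p) (NormedSpace.exp (inc P (logValue P X φ) p)) =
      Real.exp (inc P (fun t => logPartition μ (logValue P X φ t)) p) := by
    rw [tiltedMean_exp, inc, inc, add_sub_cancel]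
  have hgain : L (P.left p) (linearCombinationCLM φ (inc P X p)) =
      gain P (mixedWeights P X φ μ) X p := by
    rw [apply_linearCombinationCLM]
    rfl
  have hone : L (P.left p) 1 = 1 := tiltedMean_one μ _
  simp only [R, map_sub, map_add, map_smul, hexp, hgain, hone,
    apply_linearCombinationCLM _ (pairMul φ), smul_eq_mul]
  ring

end MixedWeights

end Mixtures

section Admissibility

theorem isC21On_of_contDiff {d m : ℕ} {f : (Fin d → ℝ) → (Fin m → ℝ) → ℝ}
    (hf : ContDiff ℝ 2 fun p : (Fin d → ℝ) × (Fin m → ℝ) => f p.1 p.2) :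
    IsC21On f Set.univ Set.univ where
  contDiffOn_one := (hf.of_le one_le_two).contDiffOn
  contDiffOn_two a _ := (hf.comp (contDiff_id.prodMk contDiff_const)).contDiffOn
  continuousOn_second := by
    let F : (Fin d → ℝ) × (Fin m → ℝ) → ℝ := fun p => f p.1 p.2
    let ι : (Fin d → ℝ) →L[ℝ] (Fin d → ℝ) × (Fin m → ℝ) := ContinuousLinearMap.inl ℝ _ _
    have hpartial (p : (Fin d → ℝ) × (Fin m → ℝ)) : iteratedFDeriv ℝ 2 (fun x => f x p.2) p.1 =
        (iteratedFDeriv ℝ 2 F p).compContinuousLinearMap fun _ => ι := by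
      have hslice : (fun x => f x p.2) = (fun z => F (z + (0, p.2))) ∘ ι := by
        funext x
        simp [F, ι]
      have hshift : ContDiff ℝ 2 fun z => F (z + (0, p.2)) :=
        hf.comp (contDiff_id.add contDiff_const)
      rw [hslice, ι.iteratedFDeriv_comp_right hshift _ le_rfl, iteratedFDeriv_comp_add_right]
      simp [ι]
    simp only [hpartial]
    exact ((ContinuousMultilinearMap.compContinuousLinearMapL (𝕜 := ℝ) (F := ℝ)
      (fun _ : Fin 2 => ι)).continuous.comp (hf.continuous_iteratedFDeriv le_rfl)).continuousOn

variable {P : RefiningPartitions} {d : ℕ} {X : ℝ≥0 → Fin d → ℝ}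
theorem InQVd.isCBVOn_bracket {m : ℕ} (hX : InQVd P X) (e : Fin m → Fin d × Fin d) (T : ℝ≥0) :
    IsCBVOn (fun t => bracket P X t ∘ e) T Set.univ where
  continuousOn :=
    (continuous_pi fun k => (continuous_apply (e k)).comp hX.continuous_bracket).continuousOn
  boundedVariationOn := HasLimSum.boundedVariationOn hX (fun k => hX.hasLimSum_bracket (e k)) T
  mem _ _ := trivial

variable {K : Type*} [TopologicalSpace K] [CompactSpace K] [MeasurableSpace K] [BorelSpace K]
  (φ : Fin d → C(K, ℝ)) (μ : Measure K) [IsFiniteMeasure μ]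

variable [NeZero μ]

theorem gradX_logPartition {m : ℕ} (b : (Fin m → ℝ) → C(K, ℝ)) (x₀ x : Fin d → ℝ)
    (a : Fin m → ℝ) (i : Fin d) :
    gradX (fun x a => logPartition μ (linearCombinationCLM φ (x - x₀) - b a)) x a i =
      tiltedMean μ (linearCombinationCLM φ (x - x₀) - b a) (φ i) := by
  have hexponent : HasFDerivAt (fun x => linearCombinationCLM φ (x - x₀) - b a)
      (linearCombinationCLM φ) x :=
    ((linearCombinationCLM φ).hasFDerivAt.comp x ((hasFDerivAt_id x).sub_const x₀)).sub_const _
  have hvalue := (hasFDerivAt_logPartition μ _).comp x hexponent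
  rw [gradX, HasFDerivAt.fderiv (f := fun x => logPartition μ _) hvalue]
  simp [apply_linearCombinationCLM, Pi.single_apply]

theorem InQVd.isAdmissibleIntegrand_mixedWeights (hX : InQVd P X) :
    IsAdmissibleIntegrand P X (mixedWeights P X φ μ) where
  inQVd := hX
  exists_gradient T _ := by
    let b : (Fin (d * d) → ℝ) →L[ℝ] C(K, ℝ) :=
      (1 / 2 : ℝ) • linearCombinationCLM (pairMul φ ∘ finProdFinEquiv.symm)
    let f (x : Fin d → ℝ) (a : Fin (d * d) → ℝ) : ℝ :=
      logPartition μ (linearCombinationCLM φ (x - X 0) - b a)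
    have hf : ContDiff ℝ 2 fun p : (Fin d → ℝ) × (Fin (d * d) → ℝ) => f p.1 p.2 :=
      (contDiff_logPartition μ).comp (by fun_prop)
    refine ⟨d * d, Set.univ, Set.univ, f, _, isOpen_univ, isOpen_univ, isC21On_of_contDiff hf,
      hX.isCBVOn_bracket finProdFinEquiv.symm T, fun t _ => ⟨trivial, funext fun i => ?_⟩⟩
    rw [gradX_logPartition φ μ b, mixedWeights, logValue,
      ← linearCombinationCLM_comp_equiv finProdFinEquiv.symm (pairMul φ)]
    rfl

end Admissibility

section Portfolio

variable {P : RefiningPartitions} {d : ℕ} {X S : ℝ≥0 → Fin d → ℝ}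

theorem mixedWeights_dirac {K : Type*} [TopologicalSpace K] [CompactSpace K] [MeasurableSpace K]
    [BorelSpace K] [MeasurableSingletonClass K] (φ : Fin d → C(K, ℝ)) (x : K) (t : ℝ≥0)
    (i : Fin d) : mixedWeights P X φ (Measure.dirac x) t i = φ i x := by
  change ∫ y, φ i y ∂(Measure.dirac x).tilted _ = φ i x
  simp [integral_tilted, integral_dirac]

/-- The coordinate functions on the simplex, which assign to a constant rebalanced portfolio its
weights. -/
def coord (i : Fin d) : C(stdSimplex ℝ (Fin d), ℝ) where
  toFun π := (π : Fin d → ℝ) i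
  continuous_toFun := (continuous_apply i).comp continuous_subtype_val

theorem mixedWeights_coord_dirac (π : stdSimplex ℝ (Fin d)) :
    mixedWeights P X coord (Measure.dirac π) = constRebalanced π :=
  funext₂ fun _ _ => mixedWeights_dirac _ _ _ _

variable (μ : Measure (stdSimplex ℝ (Fin d)))

theorem mixedWeights_coord_mem_stdSimplex [IsFiniteMeasure μ] [NeZero μ] (t : ℝ≥0) :
    mixedWeights P X coord μ t ∈ stdSimplex ℝ (Fin d) := by
  refine ⟨fun i => integral_nonneg fun π => π.2.1 i, ?_⟩
  have hsum : ∑ i, (coord i : C(stdSimplex ℝ (Fin d), ℝ)) = 1 := by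
    ext π
    simp [coord]
  simp only [mixedWeights, ← map_sum, hsum, tiltedMean_one]

variable (hM : InQVd P (itoLogVec P S))

include hM

theorem isPortfolioStrategy_mixedWeights [IsFiniteMeasure μ] [NeZero μ] :
    IsPortfolioStrategy P S (mixedWeights P (itoLogVec P S) coord μ) where
  mem_simplex := mixedWeights_coord_mem_stdSimplex μ
  admissible := hM.isAdmissibleIntegrand_mixedWeights coord μ

theorem valueProcessExists_mixedWeights [IsFiniteMeasure μ] [NeZero μ] :
    ValueProcessExists P S (mixedWeights P (itoLogVec P S) coord μ) :=
  have hweights := hM.continuous_mixedWeights coord μ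
  have hlogPartition := hM.continuous_logPartition_logValue coord μ
  have hexponential := hM.isLogExponential_logPartition coord μ
  ⟨hexponential.exists_tendsto_follmerSum hM hweights hlogPartition,
    hexponential.inQV_follmerIntegral hM hweights hlogPartition⟩

theorem portfolioValue_mixedWeights [IsProbabilityMeasure μ] (t : ℝ≥0) :
    portfolioValue P S (mixedWeights P (itoLogVec P S) coord μ) t =
      ∫ π, Real.exp (logValue P (itoLogVec P S) coord t π) ∂μ := by
  rw [portfolioValue, (hM.isLogExponential_logPartition coord μ).ddExp_follmerIntegral hM
    (hM.continuous_mixedWeights coord μ) (hM.continuous_logPartition_logValue coord μ),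
    Real.exp_sub, exp_logPartition, exp_logPartition, hM.logValue_zero]
  simp

theorem portfolioValue_constRebalanced (π : stdSimplex ℝ (Fin d)) (t : ℝ≥0) :
    portfolioValue P S (constRebalanced π) t =
      Real.exp (logValue P (itoLogVec P S) coord t π) := by
  rw [← mixedWeights_coord_dirac, portfolioValue_mixedWeights _ hM, integral_dirac]

theorem averageValue_eq (t : ℝ≥0) :
    averageValue P S μ t = ∫ π, Real.exp (logValue P (itoLogVec P S) coord t π) ∂μ := by
  simp only [averageValue, portfolioValue_constRebalanced hM]

theorem universalPortfolio_eq_mixedWeights :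
    universalPortfolio P S μ = mixedWeights P (itoLogVec P S) coord μ := by
  funext t i
  change _ = ∫ π, (π : Fin d → ℝ) i ∂μ.tilted fun π => logValue P (itoLogVec P S) coord t π
  rw [universalPortfolio, averageValue_eq μ hM, integral_tilted, ← integral_div]
  refine integral_congr_ae (Eventually.of_forall fun π => ?_)
  simp only [portfolioValue_constRebalanced hM, smul_eq_mul]
  ring

theorem isPortfolioStrategy_constRebalanced (π : stdSimplex ℝ (Fin d)) :
    IsPortfolioStrategy P S (constRebalanced π) :=
  mixedWeights_coord_dirac (P := P) (X := itoLogVec P S) π ▸ isPortfolioStrategy_mixedWeights _ hM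

theorem valueProcessExists_constRebalanced (π : stdSimplex ℝ (Fin d)) :
    ValueProcessExists P S (constRebalanced π) :=
  mixedWeights_coord_dirac (P := P) (X := itoLogVec P S) π ▸ valueProcessExists_mixedWeights _ hM

end Portfolio

end PathwiseIto

end

theorem theorem3p1 (P : RefiningPartitions) (d : ℕ) (S : ℝ≥0 → Fin d → ℝ)
    (hS : InQVd P S) (hpos : ∀ t i, 0 < S t i)
    (μ : Measure (stdSimplex ℝ (Fin d))) [IsProbabilityMeasure μ] :
    -- the Itô logarithm of the prices, all `V^π` with constant `π`, and both averages
    -- are well defined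
    (∀ i, InQV P fun t => Real.log (S t i)) ∧
    (∀ π : stdSimplex ℝ (Fin d),
      IsPortfolioStrategy P S (constRebalanced π) ∧
      ValueProcessExists P S (constRebalanced π)) ∧
    (∀ t, Integrable (fun π => portfolioValue P S (constRebalanced π) t) μ) ∧
    (∀ t i, Integrable
      (fun π : stdSimplex ℝ (Fin d) =>
        (π : Fin d → ℝ) i * portfolioValue P S (constRebalanced π) t) μ) ∧
    (∀ t, 0 < averageValue P S μ t) ∧
    -- `π̂` is a portfolio strategy, and its portfolio value process is `V̂`
    IsPortfolioStrategy P S (universalPortfolio P S μ) ∧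
    ValueProcessExists P S (universalPortfolio P S μ) ∧
    (∀ t, portfolioValue P S (universalPortfolio P S μ) t = averageValue P S μ t) := by
  have hM := hS.itoLogVec hpos
  simp only [portfolioValue_constRebalanced hM, averageValue_eq μ hM,
    universalPortfolio_eq_mixedWeights μ hM]
  refine ⟨hS.inQV_log hpos, fun π => ⟨isPortfolioStrategy_constRebalanced hM π,
      valueProcessExists_constRebalanced hM π⟩,
    fun t => integrable_exp_continuousMap μ _, fun t i => ?_,
    fun t => integral_exp_continuousMap_pos μ _, isPortfolioStrategy_mixedWeights μ hM,
    valueProcessExists_mixedWeights μ hM, portfolioValue_mixedWeights μ hM⟩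
  let g := logValue P (itoLogVec P S) coord t
  exact integrable_continuousMap μ (coord i * ⟨_, Real.continuous_exp.comp g.continuous⟩)
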